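/- Let $(X,\mu)$ be a non-atomic probability space (every measurable set of positive measure has a measurable subset of strictly smaller positive measure), and let $T\colon X\to X$ be measurable, measure preserving and ergodic. For measurable $f,g\colon X\to\mathbb{C}$ and integers $N\ge 1$ put $$A_N(f,g)(x)=\frac1N\sum_{n=1}^N f\big(T^{\lfloor\sqrt n\rfloor}x\big)\,g\big(T^n x\big).$$ Let $p_1,p_2>0$ be real numbers and define $p$ by $\frac1p=\frac1{p_1}+\frac1{p_2}$. Suppose that there is a finite constant $C$ such that $$\Big\|\sup_{N\ge 1}|A_N(f,g)|\Big\|_{L^p(X)}\le C\,\|f\|_{L^{p_1}(X)}\,\|g\|_{L^{p_2}(X)}$$ for all $f\in L^{p_1}(X)$ and $g\in L^{p_2}(X)$. Then $p\ge\frac12$. -/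

import Mathlib

open MeasureTheory
open scoped ENNReal NNReal

/-- A measure is non-atomic if it has no atoms: every measurable set of positive measure has a
measurable subset of strictly smaller positive measure. (Mathlib's `NullSingletonClass`, which says that
singletons are null, is weaker on a general measurable space.) -/
def IsNonatomic {X : Type*} [MeasurableSpace X] (μ : Measure X) : Prop :=
  ∀ s : Set X, MeasurableSet s → 0 < μ s →
    ∃ t : Set X, t ⊆ s ∧ MeasurableSet t ∧ 0 < μ t ∧ μ t < μ s

/-- The bilinear average
`A_N(f, g)(x) = (1 / N) ∑_{n = 1}^N f (T ^ ⌊√n⌋ x) * g (T ^ n x)`. -/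
noncomputable def bilinearAverage {X : Type*} (T : X → X) (N : ℕ) (f g : X → ℂ) (x : X) : ℂ :=
  (1 / (N : ℂ)) * ∑ n ∈ Finset.Icc 1 N, f (T^[⌊Real.sqrt (n : ℝ)⌋₊] x) * g (T^[n] x)

/-- The maximal function `sup_{N ≥ 1} |A_N(f, g)(x)|`, with values in `[0, ∞]`. -/
noncomputable def bilinearMaximal {X : Type*} (T : X → X) (f g : X → ℂ) (x : X) : ℝ≥0∞ :=
  ⨆ (N : ℕ) (_ : 1 ≤ N), ‖bilinearAverage T N f g x‖ₑ

/-- The maximal inequality `‖sup_N |A_N(f, g)|‖_p ≤ C ‖f‖_{p₁} ‖g‖_{p₂}` for all `f ∈ L^{p₁}` and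
`g ∈ L^{p₂}`, with a finite constant `C` independent of `f` and `g`. -/
def MaximalInequality {X : Type*} [MeasurableSpace X] (μ : Measure X) (T : X → X)
    (p₁ p₂ p : ℝ) : Prop :=
  ∃ C : ℝ≥0, ∀ f g : X → ℂ,
    MemLp f (ENNReal.ofReal p₁) μ → MemLp g (ENNReal.ofReal p₂) μ →
      eLpNorm (bilinearMaximal T f g) (ENNReal.ofReal p) μ ≤
        (C : ℝ≥0∞) * eLpNorm f (ENNReal.ofReal p₁) μ * eLpNorm g (ENNReal.ofReal p₂) μ

/-! Test the inequality on f = g = 1_E, where μ E ≤ 2/K and almost every orbit meets E in every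
window of K consecutive times. Such an orbit visits E at some time m with K ≤ m < 2K, and again at
some n = m² + j with j < K ≤ m, so ⌊√n⌋ = m. This single term makes the maximal function at least
1/(4K²) almost everywhere, while the right side is at most C (2/K)^(1/p). Letting K → ∞ forces 1/p ≤
2.

To build E, take A of tiny positive measure and collect the points whose first entrance time to A is
a multiple of K. Ergodicity makes that time finite almost everywhere. -/

/-- The set of points whose orbit enters `A` for the first time at time `k`. -/
def firstEntrance {X : Type*} (T : X → X) (A : Set X) (k : ℕ) : Set X :=
  {x | T^[k] x ∈ A ∧ ∀ j < k, T^[j] x ∉ A}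

/-- The set of points whose first entrance time to `A` is a multiple of `K`. -/
def entranceMultiple {X : Type*} (T : X → X) (A : Set X) (K : ℕ) : Set X :=
  ⋃ q : ℕ, firstEntrance T A (q * K)

theorem measurableSet_firstEntrance {X : Type*} [MeasurableSpace X] {T : X → X}
    (hT : Measurable T) {A : Set X} (hA : MeasurableSet A) (k : ℕ) :
    MeasurableSet (firstEntrance T A k) := by
  have h : firstEntrance T A k = (T^[k] ⁻¹' A) ∩ ⋂ j : ℕ, ⋂ _ : j < k, (T^[j] ⁻¹' A)ᶜ := by
    ext x
    simp [firstEntrance]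
  rw [h]
  exact (hT.iterate k hA).inter
    (MeasurableSet.iInter fun j => MeasurableSet.iInter fun _ => (hT.iterate j hA).compl)

theorem measurableSet_entranceMultiple {X : Type*} [MeasurableSpace X] {T : X → X}
    (hT : Measurable T) {A : Set X} (hA : MeasurableSet A) (K : ℕ) :
    MeasurableSet (entranceMultiple T A K) :=
  MeasurableSet.iUnion fun q => measurableSet_firstEntrance hT hA (q * K)

theorem pairwise_disjoint_firstEntrance {X : Type*} (T : X → X) (A : Set X) :
    Pairwise (Function.onFun Disjoint (firstEntrance T A)) := by
  intro i j hij
  rw [Function.onFun, Set.disjoint_left]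
  rintro x ⟨hi, hi'⟩ ⟨hj, hj'⟩
  rcases lt_or_gt_of_ne hij with h | h
  · exact hj' i h hi
  · exact hi' j h hj

/-- A point with entrance time k + 1 is mapped by T to one with entrance time k, and T preserves μ.
-/
theorem antitone_measure_firstEntrance {X : Type*} [MeasurableSpace X] {μ : Measure X}
    {T : X → X} (hT : MeasurePreserving T μ μ) {A : Set X} (hA : MeasurableSet A) :
    Antitone fun k => μ (firstEntrance T A k) := by
  refine antitone_nat_of_succ_le fun k => ?_
  rw [← hT.measure_preimage (measurableSet_firstEntrance hT.measurable hA k).nullMeasurableSet]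
  refine measure_mono ?_
  rintro x ⟨hx, hx'⟩
  exact ⟨hx, fun j hj => hx' (j + 1) (by omega)⟩

/-- The first entrance times are multiples of `K` on a set of measure at most `μ A + 1 / K`. -/
theorem measure_entranceMultiple_le {X : Type*} [MeasurableSpace X] {μ : Measure X}
    [IsProbabilityMeasure μ] {T : X → X} (hT : MeasurePreserving T μ μ) {A : Set X}
    (hA : MeasurableSet A) {K : ℕ} (hK : K ≠ 0) :
    μ (entranceMultiple T A K) ≤ μ A + (K : ℝ≥0∞)⁻¹ := by
  have : NeZero K := ⟨hK⟩
  set h : ℕ → ℝ≥0∞ := fun k => μ (firstEntrance T A k) with hh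
  have hanti : Antitone h := antitone_measure_firstEntrance hT hA
  have htotal : ∑' k, h k ≤ 1 := by
    rw [hh, ← measure_iUnion (pairwise_disjoint_firstEntrance T A)
      (measurableSet_firstEntrance hT.measurable hA)]
    exact prob_le_one
  -- By monotonicity `h ((q + 1) * K)` is at most each of the K values of `h` in the preceding
  -- block, and all blocks together have mass at most 1.
  have hblock : (K : ℝ≥0∞) * ∑' q : ℕ, h ((q + 1) * K) ≤ 1 := by
    rw [← ENNReal.tsum_mul_left]
    refine le_trans ?_ htotal
    rw [← (Nat.divModEquiv K).symm.tsum_eq h,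
      ENNReal.tsum_prod (f := fun q j => h ((Nat.divModEquiv K).symm (q, j)))]
    refine ENNReal.tsum_le_tsum fun q => ?_
    rw [tsum_fintype]
    calc (K : ℝ≥0∞) * h ((q + 1) * K) = ∑ _j : Fin K, h ((q + 1) * K) := by simp
      _ ≤ _ := Finset.sum_le_sum fun j _ => hanti (by
        have := j.isLt
        simp only [Nat.divModEquiv_symm_apply]
        nlinarith)
  calc μ (entranceMultiple T A K) ≤ ∑' q : ℕ, h (q * K) := measure_iUnion_le _
    -- The term q = 0 has no preceding block; it is the measure of A itself.
    _ = h (0 * K) + ∑' q : ℕ, h ((q + 1) * K) := tsum_eq_zero_add' ENNReal.summable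
    _ ≤ μ A + (K : ℝ≥0∞)⁻¹ := by
      refine add_le_add (measure_mono ?_) ?_
      · rintro x ⟨hx, -⟩
        simpa using hx
      · rw [← one_div, ENNReal.le_div_iff_mul_le (by simp [hK]) (by simp), mul_comm]
        exact hblock

/-- The entrance time t drops by one at each step until A is reached, so after t mod K steps it is a
multiple of K. -/
theorem exists_iterate_mem_entranceMultiple {X : Type*} {T : X → X} {A : Set X} {K : ℕ}
    (hK : K ≠ 0) {x : X} (hx : ∃ k, T^[k] x ∈ A) :
    ∃ j < K, T^[j] x ∈ entranceMultiple T A K := by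
  classical
  have hmod := Nat.div_add_mod' (Nat.find hx) K
  refine ⟨Nat.find hx % K, Nat.mod_lt _ (Nat.pos_of_ne_zero hK), Set.mem_iUnion.2
    ⟨Nat.find hx / K, ?_, fun i hi => ?_⟩⟩
  · rw [← Function.iterate_add_apply, hmod]
    exact Nat.find_spec hx
  · rw [← Function.iterate_add_apply]
    exact Nat.find_min hx (by omega)

/-- Almost every orbit of an ergodic map enters any given set of positive measure. -/
theorem Ergodic.ae_exists_iterate_mem {X : Type*} [MeasurableSpace X] {μ : Measure X}
    [IsFiniteMeasure μ] {T : X → X} (hT : Ergodic T μ) {A : Set X} (hA : MeasurableSet A)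
    (hA' : μ A ≠ 0) : ∀ᵐ x ∂μ, ∃ k, T^[k] x ∈ A := by
  have hU : MeasurableSet (⋃ k : ℕ, T^[k] ⁻¹' A) :=
    MeasurableSet.iUnion fun k => hT.measurable.iterate k hA
  have hsub : T ⁻¹' (⋃ k : ℕ, T^[k] ⁻¹' A) ⊆ ⋃ k : ℕ, T^[k] ⁻¹' A := by
    intro x hx
    obtain ⟨k, hk⟩ := Set.mem_iUnion.1 hx
    exact Set.mem_iUnion.2 ⟨k + 1, hk⟩
  rcases hT.ae_empty_or_univ_of_preimage_ae_le hU.nullMeasurableSet hsub.eventuallyLE with h | h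
  · exact absurd (measure_mono_null (Set.subset_iUnion (fun k : ℕ => T^[k] ⁻¹' A) 0)
      (ae_eq_empty.1 h)) hA'
  · filter_upwards [Filter.eventuallyEq_univ.1 h] with x hx
    exact Set.mem_iUnion.1 hx

/-- Split repeatedly and keep the smaller piece, which has at most half the measure. -/
theorem IsNonatomic.exists_measure_le_pow {X : Type*} [MeasurableSpace X] {μ : Measure X}
    [IsProbabilityMeasure μ] (hμ : IsNonatomic μ) (n : ℕ) :
    ∃ A : Set X, MeasurableSet A ∧ 0 < μ A ∧ μ A ≤ (2⁻¹ : ℝ≥0∞) ^ n := by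
  induction n with
  | zero => exact ⟨Set.univ, MeasurableSet.univ, by simp, by simp⟩
  | succ n ih =>
    obtain ⟨s, hs, hs0, hsn⟩ := ih
    obtain ⟨t, hts, ht, ht0, hlt⟩ := hμ s hs hs0
    have hadd : μ t + μ (s \ t) = μ s := by
      rw [measure_add_sdiff ht.nullMeasurableSet, Set.union_eq_right.2 hts]
    have hhalf {a : ℝ≥0∞} (ha : a + a ≤ μ s) : a ≤ (2⁻¹ : ℝ≥0∞) ^ (n + 1) := by
      rw [pow_succ, ← div_eq_mul_inv, ENNReal.le_div_iff_mul_le (by simp) (by simp), mul_two]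
      exact ha.trans hsn
    rcases le_total (μ t) (μ (s \ t)) with h | h
    · exact ⟨t, ht, ht0, hhalf ((add_le_add le_rfl h).trans hadd.le)⟩
    · refine ⟨s \ t, hs.diff ht, ?_, hhalf ((add_le_add h le_rfl).trans hadd.le)⟩
      rw [pos_iff_ne_zero]
      intro h0
      rw [h0, add_zero] at hadd
      exact hlt.ne hadd

/-- An ergodic map of a nonatomic probability space admits, for each `K`, a set of measure at most
`2 / K` which almost every orbit meets in every window of length `K`. -/
theorem Ergodic.exists_measure_le_and_iterate_mem {X : Type*} [MeasurableSpace X]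
    {μ : Measure X} [IsProbabilityMeasure μ] (hμ : IsNonatomic μ) {T : X → X} (hT : Ergodic T μ)
    {K : ℕ} (hK : K ≠ 0) :
    ∃ E : Set X, MeasurableSet E ∧ μ E ≤ 2 / (K : ℝ≥0∞) ∧
      ∀ᵐ x ∂μ, ∀ k : ℕ, ∃ j < K, T^[k + j] x ∈ E := by
  obtain ⟨n, hn⟩ := ENNReal.exists_inv_two_pow_lt (a := (K : ℝ≥0∞)⁻¹) (by simp)
  obtain ⟨A, hA, hA0, hAn⟩ := hμ.exists_measure_le_pow n
  refine ⟨entranceMultiple T A K, measurableSet_entranceMultiple hT.measurable hA K, ?_, ?_⟩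
  · calc μ (entranceMultiple T A K) ≤ μ A + (K : ℝ≥0∞)⁻¹ :=
        measure_entranceMultiple_le hT.toMeasurePreserving hA hK
      _ ≤ (K : ℝ≥0∞)⁻¹ + (K : ℝ≥0∞)⁻¹ := add_le_add (hAn.trans hn.le) le_rfl
      _ = 2 / (K : ℝ≥0∞) := by rw [← two_mul, div_eq_mul_inv]
  · rw [ae_all_iff]
    intro k
    have hk := (hT.toMeasurePreserving.iterate k).quasiMeasurePreserving.ae
      (hT.ae_exists_iterate_mem hA hA0.ne')
    filter_upwards [hk] with x hx
    obtain ⟨j, hj, hjx⟩ := exists_iterate_mem_entranceMultiple hK hx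
    refine ⟨j, hj, ?_⟩
    rwa [add_comm, Function.iterate_add_apply]

/-- If the orbit of `x` visits `E` at the times `⌊√n⌋` and `n`, then the maximal function of
`(1_E, 1_E)` is at least `1 / n` at `x`. -/
theorem inv_le_bilinearMaximal_indicator {X : Type*} {T : X → X} {E : Set X} {x : X} {n : ℕ}
    (hn : 1 ≤ n) (h₁ : T^[⌊Real.sqrt (n : ℝ)⌋₊] x ∈ E) (h₂ : T^[n] x ∈ E) :
    (n : ℝ≥0∞)⁻¹ ≤ bilinearMaximal T (E.indicator 1) (E.indicator 1) x := by
  refine le_trans ?_ (le_iSup₂ (f := fun (N : ℕ) (_ : 1 ≤ N) =>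
    ‖bilinearAverage T N (E.indicator 1) (E.indicator 1) x‖ₑ) n hn)
  have hterm (m : ℕ) : (E.indicator (1 : X → ℂ) (T^[⌊Real.sqrt (m : ℝ)⌋₊] x)) *
      E.indicator (1 : X → ℂ) (T^[m] x) =
      (((E.indicator (1 : X → ℝ) (T^[⌊Real.sqrt (m : ℝ)⌋₊] x)) *
        E.indicator (1 : X → ℝ) (T^[m] x) : ℝ) : ℂ) := by
    by_cases h : T^[⌊Real.sqrt (m : ℝ)⌋₊] x ∈ E <;> by_cases h' : T^[m] x ∈ E <;> 
      simp only [Set.indicator_of_mem, Set.indicator_of_notMem, h, h', not_false_eq_true,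
        Pi.one_apply, mul_one, mul_zero, Complex.ofReal_one, Complex.ofReal_zero]
  have hnonneg (y : X) : 0 ≤ E.indicator (1 : X → ℝ) y :=
    Set.indicator_nonneg (fun _ _ => zero_le_one) y
  have hsum : 1 ≤ ∑ m ∈ Finset.Icc 1 n, (E.indicator (1 : X → ℝ) (T^[⌊Real.sqrt (m : ℝ)⌋₊] x)) *
      E.indicator (1 : X → ℝ) (T^[m] x) := by
    refine le_trans ?_ (Finset.single_le_sum (fun m _ => mul_nonneg (hnonneg _) (hnonneg _))
      (Finset.mem_Icc.2 ⟨hn, le_rfl⟩))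
    rw [Set.indicator_of_mem h₁, Set.indicator_of_mem h₂, Pi.one_apply, Pi.one_apply, one_mul]
  have hn0 : (0 : ℝ) < n := by exact_mod_cast hn
  simp only [bilinearAverage, hterm]
  rw [← Complex.ofReal_sum, enorm_mul, one_div, enorm_inv (by exact_mod_cast hn0.ne')]
  have hcast : ‖(n : ℂ)‖ₑ = (n : ℝ≥0∞) := by
    rw [← ofReal_norm, Complex.norm_natCast, ENNReal.ofReal_natCast]
  rw [hcast]
  refine le_mul_of_one_le_right' ?_
  rw [← ofReal_norm, Complex.norm_real, ENNReal.one_le_ofReal]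
  exact hsum.trans (Real.le_norm_self _)

theorem inv_le_bilinearMaximal_of_forall_window {X : Type*} {T : X → X} {E : Set X} {x : X}
    {K : ℕ} (hK : K ≠ 0) (hx : ∀ k : ℕ, ∃ j < K, T^[k + j] x ∈ E) :
    ((4 * K ^ 2 : ℕ) : ℝ≥0∞)⁻¹ ≤ bilinearMaximal T (E.indicator 1) (E.indicator 1) x := by
  obtain ⟨i, hi, hiE⟩ := hx K
  -- Starting the first window at K rather than 0 gives j < K ≤ K + i, which keeps (K + i)² + j
  -- below the next square.
  obtain ⟨j, hj, hjE⟩ := hx ((K + i) ^ 2)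
  have hsqrt : ⌊Real.sqrt (((K + i) ^ 2 + j : ℕ) : ℝ)⌋₊ = K + i := by
    rw [Real.nat_floor_real_sqrt_eq_nat_sqrt, pow_two]
    exact Nat.sqrt_add_eq _ (by omega)
  refine le_trans ?_ (inv_le_bilinearMaximal_indicator (n := (K + i) ^ 2 + j) ?_ ?_ hjE)
  · rw [ENNReal.inv_le_inv, Nat.cast_le]
    nlinarith
  · have : 1 ≤ K := Nat.pos_of_ne_zero hK
    nlinarith
  · rwa [hsqrt]

/-- A maximal inequality forces `K ^ (1 / p) ≤ C' K ^ 2` for all `K`. -/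
theorem MaximalInequality.exists_inv_sq_le {X : Type*} [MeasurableSpace X] {μ : Measure X}
    [IsProbabilityMeasure μ] (hμ : IsNonatomic μ) {T : X → X} (hT : Ergodic T μ)
    {p₁ p₂ p : ℝ} (hp₁ : 0 < p₁) (hp₂ : 0 < p₂) (hp₀ : 0 < p) (hp : 1 / p = 1 / p₁ + 1 / p₂)
    (hmax : MaximalInequality μ T p₁ p₂ p) :
    ∃ C : ℝ≥0, ∀ K : ℕ, K ≠ 0 →
      ((4 * K ^ 2 : ℕ) : ℝ≥0∞)⁻¹ ≤ (C : ℝ≥0∞) * (2 / (K : ℝ≥0∞)) ^ (1 / p) := by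
  obtain ⟨C, hC⟩ := hmax
  refine ⟨C, fun K hK => ?_⟩
  obtain ⟨E, hE, hEK, hx⟩ := hT.exists_measure_le_and_iterate_mem hμ hK
  have hmem (q : ℝ) : MemLp (E.indicator (1 : X → ℂ)) (ENNReal.ofReal q) μ :=
    memLp_indicator_const _ hE (1 : ℂ) (Or.inr (measure_ne_top μ E))
  have hnorm {q : ℝ} (hq : 0 < q) :
      eLpNorm (E.indicator (1 : X → ℂ)) (ENNReal.ofReal q) μ = μ E ^ (1 / q) := by
    have := eLpNorm_indicator_const (μ := μ) (c := (1 : ℂ)) hE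
      (p := ENNReal.ofReal q) (by simpa using hq) (by simp)
    rw [ENNReal.toReal_ofReal hq.le, enorm_one, one_mul] at this
    exact this
  have hlow : ((4 * K ^ 2 : ℕ) : ℝ≥0∞)⁻¹ ≤
      eLpNorm (bilinearMaximal T (E.indicator 1) (E.indicator 1)) (ENNReal.ofReal p) μ := by
    calc ((4 * K ^ 2 : ℕ) : ℝ≥0∞)⁻¹
        = eLpNorm (fun _ : X => ((4 * K ^ 2 : ℕ) : ℝ≥0∞)⁻¹) (ENNReal.ofReal p) μ := by
          rw [eLpNorm_const _ (by simpa using hp₀) (IsProbabilityMeasure.ne_zero μ)]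
          simp
      _ ≤ _ := by
          refine eLpNorm_mono_enorm_ae ?_
          filter_upwards [hx] with x hx
          simpa only [enorm_eq_self] using inv_le_bilinearMaximal_of_forall_window hK hx
  refine hlow.trans ((hC _ _ (hmem p₁) (hmem p₂)).trans ?_)
  rw [hnorm hp₁, hnorm hp₂, mul_assoc, ← ENNReal.rpow_add_of_nonneg _ _ (by positivity)
    (by positivity), ← hp]
  gcongr

/-- The hypothesis bounds K^(s - 2) uniformly in K, which is impossible when s > 2. -/
theorem le_two_of_forall_inv_sq_le {s : ℝ} {C : ℝ≥0}
    (h : ∀ K : ℕ, K ≠ 0 →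
      ((4 * K ^ 2 : ℕ) : ℝ≥0∞)⁻¹ ≤ (C : ℝ≥0∞) * (2 / (K : ℝ≥0∞)) ^ s) : s ≤ 2 := by
  by_contra! hs
  have hreal (K : ℕ) (hK : K ≠ 0) : (K : ℝ) ^ (s - 2) ≤ 4 * C * 2 ^ s := by
    have hK0 : (0 : ℝ) < K := by positivity
    have h' := ENNReal.toReal_mono
      (ENNReal.mul_ne_top ENNReal.coe_ne_top (ENNReal.rpow_ne_top_of_nonneg (by linarith)
        (ENNReal.div_ne_top (by simp) (by simpa using hK)))) (h K hK)
    rw [ENNReal.toReal_inv, ENNReal.toReal_natCast, ENNReal.toReal_mul, ENNReal.coe_toReal,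
      ← ENNReal.toReal_rpow, ENNReal.toReal_div, ENNReal.toReal_natCast, ENNReal.toReal_ofNat,
      Real.div_rpow (by norm_num) hK0.le, inv_le_iff_one_le_mul₀ (by positivity)] at h'
    push_cast at h'
    rw [Real.rpow_sub hK0, Real.rpow_two, div_le_iff₀ (by positivity)]
    have hpos : 0 < (K : ℝ) ^ s := Real.rpow_pos_of_pos hK0 s
    calc (K : ℝ) ^ s = 1 * (K : ℝ) ^ s := (one_mul _).symm
      _ ≤ C * (2 ^ s / (K : ℝ) ^ s) * (4 * (K : ℝ) ^ 2) * (K : ℝ) ^ s := by gcongr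
      _ = 4 * C * 2 ^ s * (K : ℝ) ^ 2 := by field_simp
  have htends := (tendsto_rpow_atTop (sub_pos.2 hs)).comp (tendsto_natCast_atTop_atTop (R := ℝ))
  obtain ⟨K, hK, hK0⟩ := ((htends.eventually_gt_atTop (4 * C * 2 ^ s)).and
    (Filter.eventually_ne_atTop 0)).exists
  exact absurd (hreal K hK0) (not_le.2 hK)

theorem proposition1p4 {X : Type*} [MeasurableSpace X] (μ : Measure X) [IsProbabilityMeasure μ]
    (hμ : IsNonatomic μ) (T : X → X) (hT : Ergodic T μ)
    (p₁ p₂ p : ℝ) (hp₁ : 0 < p₁) (hp₂ : 0 < p₂) (hp : 1 / p = 1 / p₁ + 1 / p₂)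
    (hmax : MaximalInequality μ T p₁ p₂ p) :
    1 / 2 ≤ p := by
  have hp₀ : 0 < p := one_div_pos.1 (hp ▸ by positivity)
  obtain ⟨C, hC⟩ := hmax.exists_inv_sq_le hμ hT hp₁ hp₂ hp₀ hp
  exact (one_div_le two_pos hp₀).2 (le_two_of_forall_inv_sq_le hC)
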